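/- Let $m\ge 5$, let $p_1,p_2,p_3\in\mathbb R^2$ be pairwise distinct points and let $q_1,\dots,q_m\in\mathbb R^2$ be pairwise distinct points. Consider the framework $(K_{3,m},\mathbf p\cup\mathbf q)$ that places the three vertices of one side of the complete bipartite graph $K_{3,m}$ at $p_1,p_2,p_3$ and the $m$ vertices of the other side at $q_1,\dots,q_m$. Then either this framework is rigid, or there are two distinct lines in $\mathbb R^2$ whose union contains all the points $p_1,p_2,p_3,q_1,\dots,q_m$. Here a framework $(G,\mathbf x)$, with $G$ a finite graph on the vertex set $V$ and $\mathbf x=(x_v)_{v\in V}\in(\mathbb R^2)^V$, is called rigid if there is a neighborhood $B$ of $\mathbf x$ in $(\mathbb R^2)^V$ such that every $\mathbf x'\in B$ with $\|x_u-x_v\|=\|x'_u-x'_v\|$ for all edges $\{u,v\}$ of $G$ satisfies $\|x_u-x_v\|=\|x'_u-x'_v\|$ for all $u,v\in V$ (equivalently, some isometry of $\mathbb R^2$ maps $x_v$ to $x'_v$ for every $v\in V$). -/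

import Mathlib

/-- The Euclidean plane. -/
abbrev Plane : Type := EuclideanSpace ℝ (Fin 2)

/-- Frameworks `(G, p)` and `(G, p')` are equivalent if corresponding edges have equal length. -/
def FrameworkEquivalent {V : Type*} (G : SimpleGraph V) (p p' : V → Plane) : Prop :=
  ∀ i j : V, G.Adj i j → dist (p i) (p j) = dist (p' i) (p' j)

/-- The framework `(G, p)` is rigid: some neighbourhood `B` of `p` (in the product topology on
`V → ℝ²`) is such that every `p' ∈ B` with `(G, p')` equivalent to `(G, p)` is congruent to `p`,
that is, has the same distances between all pairs of vertices (Mathlib's `Congruent`). -/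
def IsRigidFramework {V : Type*} (G : SimpleGraph V) (p : V → Plane) : Prop :=
  ∃ B ∈ nhds p, ∀ p' ∈ B, FrameworkEquivalent G p p' → Congruent p p'

/-- A line in the plane: a nonempty affine subspace of dimension one. -/
def IsLine (l : AffineSubspace ℝ Plane) : Prop :=
  (l : Set Plane).Nonempty ∧ Module.finrank ℝ l.direction = 1

/-- All the points `p v` lie on the union of some two distinct lines. -/
def OnPairOfLines {V : Type*} (p : V → Plane) : Prop :=
  ∃ l₁ l₂ : AffineSubspace ℝ Plane, IsLine l₁ ∧ IsLine l₂ ∧ l₁ ≠ l₂ ∧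
    ∀ v : V, p v ∈ l₁ ∨ p v ∈ l₂

open Filter Topology

/-! A small deformation that preserves one distance within a side of the bipartite graph preserves
all distances: triangles over that pair keep side lengths and orientation, so the other side is
congruent, and the argument returns (`isRigidFramework_of_dist_eq`). It remains to find such a pair.

If one side has three distinct collinear points and the other a nondegenerate triangle, Stewart's
identity provides it (`dist_eq_of_collinear`). If both sides are collinear, two lines suffice.

Otherwise the `p i` form a triangle and no three `q j` are collinear. If the side `p 0`, `p 1`
changes length, the `q j` lie on a conic whose equation is positive at `p 0` and negative at a point
tending to `p 0` as `p'` tends to `p` (`exists_conic`). Five points in general position fix the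
equation up to a factor, positive here because of the sign at `p 0`. A fixed equation positive at `p
0` cannot be negative arbitrarily near it (`eventually_dist_eq`). -/

/-- Twice the signed area of the triangle `a b c`. -/
def signedArea (a b c : Plane) : ℝ :=
  (b 0 - a 0) * (c 1 - a 1) - (b 1 - a 1) * (c 0 - a 0)

/-! ### Coordinates and collinearity -/

theorem dist_eq_dist_iff (a b c d : Plane) :
    dist a b = dist c d ↔
      (a 0 - b 0) ^ 2 + (a 1 - b 1) ^ 2 = (c 0 - d 0) ^ 2 + (c 1 - d 1) ^ 2 := by
  rw [EuclideanSpace.dist_eq, EuclideanSpace.dist_eq, Real.sqrt_inj (by positivity) (by positivity)]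
  simp only [Fin.sum_univ_two, Real.dist_eq, sq_abs]

theorem plane_ext {a b : Plane} (h0 : a 0 = b 0) (h1 : a 1 = b 1) : a = b := by
  ext i
  fin_cases i
  · exact h0
  · exact h1

theorem sqNorm_sub_pos {a b : Plane} (h : a ≠ b) :
    0 < (b 0 - a 0) ^ 2 + (b 1 - a 1) ^ 2 := by
  by_contra hle
  apply h
  apply plane_ext <;> nlinarith [sq_nonneg (b 0 - a 0), sq_nonneg (b 1 - a 1)]

/-- A point collinear with `a ≠ b` is an affine combination of `a` and `b`. -/
theorem exists_coord_of_signedArea_eq_zero {a b c : Plane} (hab : a ≠ b)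
    (h : signedArea a b c = 0) :
    ∃ t : ℝ, c 0 = a 0 + t * (b 0 - a 0) ∧ c 1 = a 1 + t * (b 1 - a 1) := by
  have hpos := sqNorm_sub_pos hab
  unfold signedArea at h
  refine ⟨((c 0 - a 0) * (b 0 - a 0) + (c 1 - a 1) * (b 1 - a 1)) /
    ((b 0 - a 0) ^ 2 + (b 1 - a 1) ^ 2), ?_, ?_⟩
  · field_simp
    linear_combination -(b 1 - a 1) * h
  · field_simp
    linear_combination (b 0 - a 0) * h

/-! ### Distances forced by other distances -/

/-- If the distances between a nondegenerate triangle and three distinct collinear points are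
preserved, then so are the distances between the collinear points. -/
theorem dist_eq_of_collinear {p p' y y' : Fin 3 → Plane}
    (hp' : signedArea (p' 0) (p' 1) (p' 2) ≠ 0) (hy : Function.Injective y)
    (hcol : signedArea (y 0) (y 1) (y 2) = 0)
    (h : ∀ i j, dist (p i) (y j) = dist (p' i) (y' j)) :
    dist (y 0) (y 1) = dist (y' 0) (y' 1) := by
  obtain ⟨t, ht0, ht1⟩ := exists_coord_of_signedArea_eq_zero (hy.ne (by decide : (0 : Fin 3) ≠ 1)) hcol
  have t0 : t ≠ 0 := by
    rintro rfl
    exact hy.ne (by decide : (2 : Fin 3) ≠ 0) (plane_ext (by linarith) (by linarith))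
  have t1 : 1 - t ≠ 0 := by
    intro ht
    obtain rfl : t = 1 := by linarith
    exact hy.ne (by decide : (2 : Fin 3) ≠ 1) (plane_ext (by linarith) (by linarith))
  simp only [dist_eq_dist_iff] at h ⊢
  -- Stewart's identity: the right-hand side does not depend on `p i`.
  have key : ∀ i, (1 - t) * ((p i 0 - y 0 0) ^ 2 + (p i 1 - y 0 1) ^ 2) +
      t * ((p i 0 - y 1 0) ^ 2 + (p i 1 - y 1 1) ^ 2) -
      ((p i 0 - y 2 0) ^ 2 + (p i 1 - y 2 1) ^ 2) =
      t * (1 - t) * ((y 0 0 - y 1 0) ^ 2 + (y 0 1 - y 1 1) ^ 2) := by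
    intro i
    rw [ht0, ht1]
    ring
  have key' : ∀ i, (1 - t) * ((p' i 0 - y' 0 0) ^ 2 + (p' i 1 - y' 0 1) ^ 2) +
      t * ((p' i 0 - y' 1 0) ^ 2 + (p' i 1 - y' 1 1) ^ 2) -
      ((p' i 0 - y' 2 0) ^ 2 + (p' i 1 - y' 2 1) ^ 2) =
      t * (1 - t) * ((y 0 0 - y 1 0) ^ 2 + (y 0 1 - y 1 1) ^ 2) := by
    intro i
    rw [← key i, h i 0, h i 1, h i 2]
  -- `(e0, e1)` is half the gradient of the left-hand side of `key'`, an affine function of the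
  -- point `p' i`. It takes equal values at three noncollinear points, so the gradient vanishes.
  set e0 := y' 2 0 - (y' 0 0 + t * (y' 1 0 - y' 0 0)) with he0
  set e1 := y' 2 1 - (y' 0 1 + t * (y' 1 1 - y' 0 1)) with he1
  have hu : e0 * (p' 1 0 - p' 0 0) + e1 * (p' 1 1 - p' 0 1) = 0 := by
    linear_combination (key' 1 - key' 0) / 2
  have hw : e0 * (p' 2 0 - p' 0 0) + e1 * (p' 2 1 - p' 0 1) = 0 := by
    linear_combination (key' 2 - key' 0) / 2
  unfold signedArea at hp'
  have e0z : e0 = 0 := by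
    apply (mul_eq_zero.1 _).resolve_left hp'
    linear_combination (p' 2 1 - p' 0 1) * hu - (p' 1 1 - p' 0 1) * hw
  have e1z : e1 = 0 := by
    apply (mul_eq_zero.1 _).resolve_left hp'
    linear_combination (p' 1 0 - p' 0 0) * hw - (p' 2 0 - p' 0 0) * hu
  have hk := key' 0
  rw [show y' 2 0 = y' 0 0 + t * (y' 1 0 - y' 0 0) by linarith,
    show y' 2 1 = y' 0 1 + t * (y' 1 1 - y' 0 1) by linarith] at hk
  apply mul_left_cancel₀ (mul_ne_zero t0 t1)
  linear_combination -hk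

/-- If the triangles `a b x` and `a b y` keep their side lengths and orientations, then the distance
between `x` and `y` is preserved. -/
theorem dist_eq_of_orientation {a b x y a' b' x' y' : Plane} (hne : a ≠ b)
    (hab : dist a b = dist a' b') (hax : dist a x = dist a' x') (hbx : dist b x = dist b' x')
    (hay : dist a y = dist a' y') (hby : dist b y = dist b' y')
    (hx : signedArea a b x ≠ 0 → 0 < signedArea a b x * signedArea a' b' x')
    (hy : signedArea a b y ≠ 0 → 0 < signedArea a b y * signedArea a' b' y') :
    dist x y = dist x' y' := by
  rw [dist_eq_dist_iff] at *
  have area_eq : ∀ {z z' : Plane},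
      (a 0 - z 0) ^ 2 + (a 1 - z 1) ^ 2 = (a' 0 - z' 0) ^ 2 + (a' 1 - z' 1) ^ 2 →
      (b 0 - z 0) ^ 2 + (b 1 - z 1) ^ 2 = (b' 0 - z' 0) ^ 2 + (b' 1 - z' 1) ^ 2 →
      (signedArea a b z ≠ 0 → 0 < signedArea a b z * signedArea a' b' z') →
      signedArea a b z = signedArea a' b' z' := by
    intro z z' haz hbz hz
    have hin : (b 0 - a 0) * (z 0 - a 0) + (b 1 - a 1) * (z 1 - a 1) =
        (b' 0 - a' 0) * (z' 0 - a' 0) + (b' 1 - a' 1) * (z' 1 - a' 1) := by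
      linear_combination (haz - hbz + hab) / 2
    have hsq : signedArea a b z ^ 2 = signedArea a' b' z' ^ 2 := by
      have e : ∀ u v w : Plane, signedArea u v w ^ 2 =
          ((u 0 - v 0) ^ 2 + (u 1 - v 1) ^ 2) * ((u 0 - w 0) ^ 2 + (u 1 - w 1) ^ 2) -
          ((v 0 - u 0) * (w 0 - u 0) + (v 1 - u 1) * (w 1 - u 1)) ^ 2 := by
        intro u v w
        unfold signedArea
        ring
      rw [e, e, hin, hab, haz]
    rcases sq_eq_sq_iff_eq_or_eq_neg.1 hsq with h | h
    · exact h
    · by_cases h0 : signedArea a b z = 0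
      · linarith
      · have hlt := hz h0
        rw [h, neg_mul, Left.neg_pos_iff] at hlt
        exact absurd hlt (mul_self_nonneg _).not_gt
  have hAx := area_eq hax hbx hx
  have hAy := area_eq hay hby hy
  unfold signedArea at hAx hAy
  -- The inner and cross products of `x - y` with `b - a ≠ 0` determine its length, by Lagrange's
  -- identity `hid`.
  have hd : (b 0 - a 0) * (x 0 - y 0) + (b 1 - a 1) * (x 1 - y 1) =
      (b' 0 - a' 0) * (x' 0 - y' 0) + (b' 1 - a' 1) * (x' 1 - y' 1) := by
    linear_combination (hax - hbx - hay + hby) / 2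
  have hc : (b 0 - a 0) * (x 1 - y 1) - (b 1 - a 1) * (x 0 - y 0) =
      (b' 0 - a' 0) * (x' 1 - y' 1) - (b' 1 - a' 1) * (x' 0 - y' 0) := by
    linear_combination hAx - hAy
  apply mul_left_cancel₀ (sqNorm_sub_pos hne).ne'
  have hid : ∀ u v s t : ℝ, (u ^ 2 + v ^ 2) * (s ^ 2 + t ^ 2) =
      (u * s + v * t) ^ 2 + (u * t - v * s) ^ 2 := by
    intros
    ring
  rw [hid, hd, hc, ← hid]
  linear_combination -((x' 0 - y' 0) ^ 2 + (x' 1 - y' 1) ^ 2) * hab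

/-! ### Conics through five points -/

/-- A polynomial function of degree at most one on the plane. -/
def IsAffineFun (F : ℝ → ℝ → ℝ) : Prop :=
  ∃ a b c : ℝ, ∀ x y, F x y = a * x + b * y + c

/-- A polynomial function of degree at most two on the plane. -/
def IsQuadraticFun (F : ℝ → ℝ → ℝ) : Prop :=
  ∃ a b c d e f : ℝ, ∀ x y, F x y = a * x ^ 2 + b * x * y + c * y ^ 2 + d * x + e * y + f

theorem IsAffineFun.sq {F : ℝ → ℝ → ℝ} (hF : IsAffineFun F) :
    IsQuadraticFun fun x y => F x y ^ 2 := by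
  obtain ⟨a, b, c, h⟩ := hF
  refine ⟨a ^ 2, 2 * a * b, b ^ 2, 2 * a * c, 2 * b * c, c ^ 2, fun x y => ?_⟩
  simp only [h]
  ring

theorem IsQuadraticFun.linearCombination {F G : ℝ → ℝ → ℝ} (hF : IsQuadraticFun F)
    (hG : IsQuadraticFun G) (k l : ℝ) : IsQuadraticFun fun x y => k * F x y + l * G x y := by
  obtain ⟨a, b, c, d, e, f, h⟩ := hF
  obtain ⟨a', b', c', d', e', f', h'⟩ := hG
  refine ⟨k * a + l * a', k * b + l * b', k * c + l * c', k * d + l * d', k * e + l * e',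
    k * f + l * f', fun x y => ?_⟩
  simp only [h, h']
  ring

/-- An affine change of coordinates preserves quadratic functions. -/
theorem IsQuadraticFun.comp_affine {F : ℝ → ℝ → ℝ} (hF : IsQuadraticFun F) (a b : ℝ)
    (u v w z : ℝ) : IsQuadraticFun fun s t => F (a + s * u + t * w) (b + s * v + t * z) := by
  obtain ⟨c₁, c₂, c₃, c₄, c₅, c₆, h⟩ := hF
  refine ⟨c₁ * u ^ 2 + c₂ * u * v + c₃ * v ^ 2, 2 * c₁ * u * w + c₂ * (u * z + v * w) +
    2 * c₃ * v * z, c₁ * w ^ 2 + c₂ * w * z + c₃ * z ^ 2, 2 * c₁ * a * u + c₂ * (a * v + b * u) +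
    2 * c₃ * b * v + c₄ * u + c₅ * v, 2 * c₁ * a * w + c₂ * (a * z + b * w) +
    2 * c₃ * b * z + c₄ * w + c₅ * z, c₁ * a ^ 2 + c₂ * a * b + c₃ * b ^ 2 + c₄ * a + c₅ * b + c₆,
    fun s t => ?_⟩
  simp only [h]
  ring

/-- A conic through five points in general position and a sixth point on the line through the first
two of them is the whole plane. -/
theorem IsQuadraticFun.eq_zero {F : ℝ → ℝ → ℝ} (hF : IsQuadraticFun F) {q : Fin 5 → Plane}
    (hgen : ∀ i j k, i ≠ j → i ≠ k → j ≠ k → signedArea (q i) (q j) (q k) ≠ 0)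
    (hq : ∀ j, F (q j 0) (q j 1) = 0)
    (hr : F (2 * q 1 0 - q 0 0) (2 * q 1 1 - q 0 1) = 0) (x y : ℝ) : F x y = 0 := by
  have h012 := hgen 0 1 2 (by decide) (by decide) (by decide)
  have h013 := hgen 0 1 3 (by decide) (by decide) (by decide)
  have h014 := hgen 0 1 4 (by decide) (by decide) (by decide)
  have h234 := hgen 2 3 4 (by decide) (by decide) (by decide)
  set D := signedArea (q 0) (q 1) (q 2) with hD
  have hcoord : ∀ x y : ℝ, ∃ s t : ℝ, x = q 0 0 + s * (q 1 0 - q 0 0) + t * (q 2 0 - q 0 0) ∧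
      y = q 0 1 + s * (q 1 1 - q 0 1) + t * (q 2 1 - q 0 1) := by
    intro x y
    refine ⟨((x - q 0 0) * (q 2 1 - q 0 1) - (y - q 0 1) * (q 2 0 - q 0 0)) / D,
      ((y - q 0 1) * (q 1 0 - q 0 0) - (x - q 0 0) * (q 1 1 - q 0 1)) / D, ?_, ?_⟩
    · field_simp
      rw [hD]
      unfold signedArea
      ring
    · field_simp
      rw [hD]
      unfold signedArea
      ring
  -- In these affine coordinates `q 0`, `q 1`, `q 2` and the sixth point are `(0, 0)`, `(1, 0)`,
  -- `(0, 1)` and `(2, 0)`.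
  obtain ⟨a, b, c, d, e, f, hG⟩ := hF.comp_affine (q 0 0) (q 0 1) (q 1 0 - q 0 0) (q 1 1 - q 0 1)
    (q 2 0 - q 0 0) (q 2 1 - q 0 1)
  beta_reduce at hG
  obtain ⟨s₃, t₃, hx₃, hy₃⟩ := hcoord (q 3 0) (q 3 1)
  obtain ⟨s₄, t₄, hx₄, hy₄⟩ := hcoord (q 4 0) (q 4 1)
  have e013 : signedArea (q 0) (q 1) (q 3) = t₃ * D := by
    rw [hD]
    unfold signedArea
    rw [hx₃, hy₃]
    ring
  have e014 : signedArea (q 0) (q 1) (q 4) = t₄ * D := by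
    rw [hD]
    unfold signedArea
    rw [hx₄, hy₄]
    ring
  have e234 : signedArea (q 2) (q 3) (q 4) = (s₃ * (t₄ - 1) - s₄ * (t₃ - 1)) * D := by
    rw [hD]
    unfold signedArea
    rw [hx₃, hy₃, hx₄, hy₄]
    ring
  rw [e013] at h013
  rw [e014] at h014
  rw [e234] at h234
  have ht₃ := left_ne_zero_of_mul h013
  have ht₄ := left_ne_zero_of_mul h014
  have hdet := left_ne_zero_of_mul h234
  have g0 := hG 0 0
  have g1 := hG 1 0
  have g2 := hG 0 1
  have gr := hG 2 0
  have g3 := hG s₃ t₃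
  have g4 := hG s₄ t₄
  simp only [← hx₃, ← hy₃, hq] at g3
  simp only [← hx₄, ← hy₄, hq] at g4
  rw [show q 0 0 + 0 * (q 1 0 - q 0 0) + 0 * (q 2 0 - q 0 0) = q 0 0 by ring,
    show q 0 1 + 0 * (q 1 1 - q 0 1) + 0 * (q 2 1 - q 0 1) = q 0 1 by ring, hq] at g0
  rw [show q 0 0 + 1 * (q 1 0 - q 0 0) + 0 * (q 2 0 - q 0 0) = q 1 0 by ring,
    show q 0 1 + 1 * (q 1 1 - q 0 1) + 0 * (q 2 1 - q 0 1) = q 1 1 by ring, hq] at g1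
  rw [show q 0 0 + 0 * (q 1 0 - q 0 0) + 1 * (q 2 0 - q 0 0) = q 2 0 by ring,
    show q 0 1 + 0 * (q 1 1 - q 0 1) + 1 * (q 2 1 - q 0 1) = q 2 1 by ring, hq] at g2
  rw [show q 0 0 + 2 * (q 1 0 - q 0 0) + 0 * (q 2 0 - q 0 0) = 2 * q 1 0 - q 0 0 by ring,
    show q 0 1 + 2 * (q 1 1 - q 0 1) + 0 * (q 2 1 - q 0 1) = 2 * q 1 1 - q 0 1 by ring, hr] at gr
  -- Three zeros on `t = 0` leave `t * (b * s + c * (t - 1))`. The second factor vanishes at `q 2`,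
  -- `q 3`, `q 4`, which are not collinear, so it is zero.
  have hf : f = 0 := by linarith
  have ha : a = 0 := by linarith
  have hd : d = 0 := by linarith
  have he : e = -c := by linarith
  subst hf ha hd he
  have k3 : b * s₃ + c * (t₃ - 1) = 0 := by
    apply (mul_eq_zero.1 _).resolve_left ht₃
    linear_combination -g3
  have k4 : b * s₄ + c * (t₄ - 1) = 0 := by
    apply (mul_eq_zero.1 _).resolve_left ht₄
    linear_combination -g4
  have hb : b = 0 := by
    apply (mul_eq_zero.1 _).resolve_left hdet
    linear_combination (t₄ - 1) * k3 - (t₃ - 1) * k4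
  have hc : c = 0 := by
    apply (mul_eq_zero.1 _).resolve_left hdet
    linear_combination s₃ * k4 - s₄ * k3
  obtain ⟨s, t, rfl, rfl⟩ := hcoord x y
  rw [hG, hb, hc]
  ring

/-- Half the change of the squared distance between the points `0` and `i` of a triangle. -/
noncomputable def halfSqDistChange (p p' : Fin 3 → Plane) (i : Fin 3) : ℝ :=
  ((p' i 0 - p' 0 0) ^ 2 + (p' i 1 - p' 0 1) ^ 2 - (p i 0 - p 0 0) ^ 2 - (p i 1 - p 0 1) ^ 2) / 2

/-- The point near `p 0` that the affine map matching distances to `p` with distances to `p'`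
sends to `p' 0`, first coordinate. -/
noncomputable def shiftX (p p' : Fin 3 → Plane) : ℝ :=
  p 0 0 - (halfSqDistChange p p' 1 * (p 2 1 - p 0 1) - halfSqDistChange p p' 2 * (p 1 1 - p 0 1)) /
    signedArea (p 0) (p 1) (p 2)

/-- The point near `p 0` that the affine map matching distances to `p` with distances to `p'`
sends to `p' 0`, second coordinate. -/
noncomputable def shiftY (p p' : Fin 3 → Plane) : ℝ :=
  p 0 1 - (halfSqDistChange p p' 2 * (p 1 0 - p 0 0) - halfSqDistChange p p' 1 * (p 2 0 - p 0 0)) /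
    signedArea (p 0) (p 1) (p 2)

/-- The points whose distances to `p` are realised as distances to a triangle `p'` lie on a conic,
which separates `p 0` from the point `(shiftX p p', shiftY p p')` when the length of the side
`p 0`, `p 1` changes. -/
theorem exists_conic {p p' : Fin 3 → Plane} (hp : signedArea (p 0) (p 1) (p 2) ≠ 0)
    (hp' : signedArea (p' 0) (p' 1) (p' 2) ≠ 0) (hne : dist (p 0) (p 1) ≠ dist (p' 0) (p' 1)) :
    ∃ F : ℝ → ℝ → ℝ, IsQuadraticFun F ∧
      (∀ q q' : Plane, (∀ i, dist (p i) q = dist (p' i) q') → F (q 0) (q 1) = 0) ∧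
      0 < F (p 0 0) (p 0 1) ∧ F (shiftX p p') (shiftY p p') < 0 := by
  set k := halfSqDistChange p p' with hk
  have hk1 : k 1 ≠ 0 := by
    intro h
    apply hne
    rw [dist_eq_dist_iff]
    simp only [hk, halfSqDistChange] at h
    linarith
  set D := signedArea (p 0) (p 1) (p 2) with hD
  set D' := signedArea (p' 0) (p' 1) (p' 2) with hD'
  -- For matching `q` and `q'`, `α` and `β` are the inner products of `q' - p' 0` with the sides of
  -- `p'` at `p' 0`. Cramer's rule then recovers `q' - p' 0` as `(z₀, z₁)`, an affine function of
  -- `q`.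
  set α : ℝ → ℝ → ℝ := fun x y =>
    (x - p 0 0) * (p 1 0 - p 0 0) + (y - p 0 1) * (p 1 1 - p 0 1) + k 1 with hα
  set β : ℝ → ℝ → ℝ := fun x y =>
    (x - p 0 0) * (p 2 0 - p 0 0) + (y - p 0 1) * (p 2 1 - p 0 1) + k 2 with hβ
  set z₀ : ℝ → ℝ → ℝ := fun x y =>
    (α x y * (p' 2 1 - p' 0 1) - β x y * (p' 1 1 - p' 0 1)) / D' with hz₀
  set z₁ : ℝ → ℝ → ℝ := fun x y =>
    (β x y * (p' 1 0 - p' 0 0) - α x y * (p' 2 0 - p' 0 0)) / D' with hz₁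
  have hcombo : ∀ l m : ℝ, IsAffineFun fun x y => (α x y * l - β x y * m) / D' := by
    intro l m
    refine ⟨((p 1 0 - p 0 0) * l - (p 2 0 - p 0 0) * m) / D',
      ((p 1 1 - p 0 1) * l - (p 2 1 - p 0 1) * m) / D',
      (α 0 0 * l - β 0 0 * m) / D', fun x y => ?_⟩
    simp only [hα, hβ]
    ring
  have hz₀' : IsAffineFun z₀ := hcombo _ _
  have hz₁' : IsAffineFun z₁ := by
    obtain ⟨a, b, c, h⟩ := hcombo (-(p' 2 0 - p' 0 0)) (-(p' 1 0 - p' 0 0))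
    refine ⟨a, b, c, fun x y => ?_⟩
    rw [← h]
    simp only [hz₁]
    ring
  have hx : IsAffineFun fun x _ => x - p 0 0 := ⟨1, 0, -p 0 0, fun x y => by ring⟩
  have hy : IsAffineFun fun _ y => y - p 0 1 := ⟨0, 1, -p 0 1, fun x y => by ring⟩
  -- The conic is `z₀ ^ 2 + z₁ ^ 2 = |q - p 0| ^ 2`, which expresses `|q' - p' 0| = |q - p 0|`.
  have hquad := (hz₀'.sq.linearCombination hz₁'.sq 1 1).linearCombination
    (hx.sq.linearCombination hy.sq 1 1) 1 (-1)
  refine ⟨_, hquad, ?_, ?_, ?_⟩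
  · intro q q' h
    simp only [dist_eq_dist_iff] at h
    have hα' : α (q 0) (q 1) = (q' 0 - p' 0 0) * (p' 1 0 - p' 0 0) +
        (q' 1 - p' 0 1) * (p' 1 1 - p' 0 1) := by
      simp only [hα, hk, halfSqDistChange]
      linear_combination (h 0 - h 1) / 2
    have hβ' : β (q 0) (q 1) = (q' 0 - p' 0 0) * (p' 2 0 - p' 0 0) +
        (q' 1 - p' 0 1) * (p' 2 1 - p' 0 1) := by
      simp only [hβ, hk, halfSqDistChange]
      linear_combination (h 0 - h 2) / 2
    have e0 : z₀ (q 0) (q 1) = q' 0 - p' 0 0 := by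
      simp only [hz₀, hα', hβ']
      field_simp
      rw [hD']
      unfold signedArea
      ring
    have e1 : z₁ (q 0) (q 1) = q' 1 - p' 0 1 := by
      simp only [hz₁, hα', hβ']
      field_simp
      rw [hD']
      unfold signedArea
      ring
    rw [e0, e1]
    linear_combination -h 0
  · have hα0 : α (p 0 0) (p 0 1) = k 1 := by
      simp only [hα]
      ring
    have hin : z₀ (p 0 0) (p 0 1) * (p' 1 0 - p' 0 0) + z₁ (p 0 0) (p 0 1) * (p' 1 1 - p' 0 1) =
        k 1 := by
      rw [← hα0]
      simp only [hz₀, hz₁]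
      field_simp
      rw [hD']
      unfold signedArea
      ring
    have hpos : 0 < z₀ (p 0 0) (p 0 1) ^ 2 + z₁ (p 0 0) (p 0 1) ^ 2 := by
      by_contra hle
      apply hk1
      have h0 : z₀ (p 0 0) (p 0 1) = 0 := by
        nlinarith [sq_nonneg (z₀ (p 0 0) (p 0 1)), sq_nonneg (z₁ (p 0 0) (p 0 1))]
      have h1 : z₁ (p 0 0) (p 0 1) = 0 := by
        nlinarith [sq_nonneg (z₀ (p 0 0) (p 0 1)), sq_nonneg (z₁ (p 0 0) (p 0 1))]
      rw [← hin, h0, h1]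
      ring
    simp only [sub_self]
    linarith
  · have hα0 : α (shiftX p p') (shiftY p p') = 0 := by
      simp only [hα, shiftX, shiftY, ← hk, ← hD]
      field_simp
      rw [hD]
      unfold signedArea
      ring
    have hβ0 : β (shiftX p p') (shiftY p p') = 0 := by
      simp only [hβ, shiftX, shiftY, ← hk, ← hD]
      field_simp
      rw [hD]
      unfold signedArea
      ring
    have e0 : z₀ (shiftX p p') (shiftY p p') = 0 := by simp [hz₀, hα0, hβ0]
    have e1 : z₁ (shiftX p p') (shiftY p p') = 0 := by simp [hz₁, hα0, hβ0]
    rw [e0, e1]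
    have hpos : 0 < (shiftX p p' - p 0 0) ^ 2 + (shiftY p p' - p 0 1) ^ 2 := by
      by_contra hle
      have h0 : shiftX p p' - p 0 0 = 0 := by
        nlinarith [sq_nonneg (shiftX p p' - p 0 0), sq_nonneg (shiftY p p' - p 0 1)]
      have h1 : shiftY p p' - p 0 1 = 0 := by
        nlinarith [sq_nonneg (shiftX p p' - p 0 0), sq_nonneg (shiftY p p' - p 0 1)]
      apply hk1
      simp only [hα, h0, h1] at hα0
      linarith
    linarith

/-- Quadratic functions vanishing at five points in general position are proportional. -/
theorem IsQuadraticFun.proportional {F G : ℝ → ℝ → ℝ} (hF : IsQuadraticFun F)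
    (hG : IsQuadraticFun G) {q : Fin 5 → Plane}
    (hgen : ∀ i j k, i ≠ j → i ≠ k → j ≠ k → signedArea (q i) (q j) (q k) ≠ 0)
    (hFq : ∀ j, F (q j 0) (q j 1) = 0) (hGq : ∀ j, G (q j 0) (q j 1) = 0) {x₀ y₀ : ℝ}
    (hF₀ : 0 < F x₀ y₀) (hG₀ : 0 < G x₀ y₀) : ∃ c : ℝ, 0 < c ∧ ∀ x y, F x y = c * G x y := by
  set Fr := F (2 * q 1 0 - q 0 0) (2 * q 1 1 - q 0 1) with hFr
  set Gr := G (2 * q 1 0 - q 0 0) (2 * q 1 1 - q 0 1) with hGr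
  -- The coefficients make this combination vanish at the sixth point as well.
  have hprop : ∀ x y, Gr * F x y + -Fr * G x y = 0 := by
    refine (hF.linearCombination hG Gr (-Fr)).eq_zero hgen ?_ ?_
    · intro j
      simp [hFq, hGq]
    · simp only [← hFr, ← hGr]
      ring
  have hGr0 : Gr ≠ 0 := fun h => hG₀.ne' (hG.eq_zero hgen hGq h x₀ y₀)
  have heq : ∀ x y, F x y = Fr / Gr * G x y := by
    intro x y
    field_simp
    linear_combination hprop x y
  refine ⟨Fr / Gr, ?_, heq⟩
  rw [heq] at hF₀
  exact pos_of_mul_pos_left hF₀ hG₀.le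

/-! ### Small deformations and rigidity -/

theorem continuous_signedArea {X : Type*} [TopologicalSpace X] {f g h : X → Plane}
    (hf : Continuous f) (hg : Continuous g) (hh : Continuous h) :
    Continuous fun x => signedArea (f x) (g x) (h x) := by
  unfold signedArea
  fun_prop

/-- For a triangle `p` and five points in general position, no small deformation of `K_{3,5}`
changes the length of the side `p 0`, `p 1`. -/
theorem eventually_dist_eq {p : Fin 3 → Plane} {q : Fin 5 → Plane}
    (hp : signedArea (p 0) (p 1) (p 2) ≠ 0)
    (hgen : ∀ i j k, i ≠ j → i ≠ k → j ≠ k → signedArea (q i) (q j) (q k) ≠ 0) :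
    ∀ᶠ p' in 𝓝 p, (∃ q' : Fin 5 → Plane, ∀ i j, dist (p i) (q j) = dist (p' i) (q' j)) →
      dist (p 0) (p 1) = dist (p' 0) (p' 1) := by
  have hev : ∀ᶠ p' : Fin 3 → Plane in 𝓝 p, signedArea (p' 0) (p' 1) (p' 2) ≠ 0 :=
    (continuous_signedArea (continuous_apply 0) (continuous_apply 1)
      (continuous_apply 2)).continuousAt.eventually_ne hp
  by_contra hnot
  rw [not_eventually] at hnot
  obtain ⟨p₀, hp₀, hp₀'⟩ := (hnot.and_eventually hev).exists
  push Not at hp₀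
  obtain ⟨⟨q₀, hq₀⟩, hne₀⟩ := hp₀
  obtain ⟨G, hG, hGq, hGpos, -⟩ := exists_conic hp hp₀' hne₀
  -- The first bad `p₀` fixes `G`. The second, `p₁`, is taken so close to `p` that its shifted
  -- point, which is `p 0` when `p' = p`, still has `G` positive.
  have hGev : ∀ᶠ p' in 𝓝 p, 0 < G (shiftX p p') (shiftY p p') := by
    have hcont : Continuous fun p' : Fin 3 → Plane => G (shiftX p p') (shiftY p p') := by
      obtain ⟨a, b, c, d, e, f, h⟩ := hG
      simp only [h]
      unfold shiftX shiftY halfSqDistChange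
      fun_prop
    refine hcont.continuousAt.eventually_const_lt ?_
    simpa [shiftX, shiftY, halfSqDistChange] using hGpos
  obtain ⟨p₁, ⟨hp₁, hp₁'⟩, hG₁⟩ := ((hnot.and_eventually hev).and_eventually hGev).exists
  push Not at hp₁
  obtain ⟨⟨q₁, hq₁⟩, hne₁⟩ := hp₁
  obtain ⟨F, hF, hFq, hFpos, hFneg⟩ := exists_conic hp hp₁' hne₁
  obtain ⟨c, hc, hFG⟩ := hF.proportional hG hgen (fun j => hFq _ _ fun i => hq₁ i j)
    (fun j => hGq _ _ fun i => hq₀ i j) hFpos hGpos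
  rw [hFG] at hFneg
  exact absurd (mul_pos hc hG₁) hFneg.not_gt

theorem eventually_same_orientation {V : Type*} [Finite V] (x : V → Plane) :
    ∀ᶠ x' in 𝓝 x, ∀ a b c, signedArea (x a) (x b) (x c) ≠ 0 →
      0 < signedArea (x a) (x b) (x c) * signedArea (x' a) (x' b) (x' c) := by
  refine eventually_all.2 fun a => eventually_all.2 fun b => eventually_all.2 fun c =>
    eventually_imp_distrib_left.2 fun h => ?_
  have hcont : Continuous fun x' : V → Plane =>
      signedArea (x a) (x b) (x c) * signedArea (x' a) (x' b) (x' c) :=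
    continuous_const.mul (continuous_signedArea (continuous_apply a) (continuous_apply b)
      (continuous_apply c))
  exact hcont.continuousAt.eventually_const_lt (mul_self_pos.2 h)

theorem isRigidFramework_of_eventually {V : Type*} {G : SimpleGraph V} {x : V → Plane}
    (h : ∀ᶠ x' in 𝓝 x, FrameworkEquivalent G x x' →
      ∀ v w, dist (x v) (x w) = dist (x' v) (x' w)) : IsRigidFramework G x := by
  refine ⟨_, h, fun x' hx' heq v w => ?_⟩
  rw [edist_dist, edist_dist, hx' heq v w]

/-- If near `x` some distance between distinct vertices on the same side of a complete bipartite
framework is preserved, then the framework is rigid. -/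
theorem isRigidFramework_of_dist_eq {ι κ : Type*} [Finite ι] [Finite κ] [Nontrivial ι]
    [Nontrivial κ] {x : ι ⊕ κ → Plane}
    (hι : Function.Injective (x ∘ Sum.inl)) (hκ : Function.Injective (x ∘ Sum.inr))
    (h : ∀ᶠ x' in 𝓝 x, FrameworkEquivalent (completeBipartiteGraph ι κ) x x' →
      (∃ i j : ι, i ≠ j ∧ dist (x (.inl i)) (x (.inl j)) = dist (x' (.inl i)) (x' (.inl j))) ∨
      ∃ i j : κ, i ≠ j ∧ dist (x (.inr i)) (x (.inr j)) = dist (x' (.inr i)) (x' (.inr j))) :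
    IsRigidFramework (completeBipartiteGraph ι κ) x := by
  apply isRigidFramework_of_eventually
  filter_upwards [h, eventually_same_orientation x] with x' hx' hor heq
  have hlr : ∀ i j, dist (x (.inl i)) (x (.inr j)) = dist (x' (.inl i)) (x' (.inr j)) :=
    fun i j => heq _ _ (by simp)
  have hrl : ∀ i j, dist (x (.inr j)) (x (.inl i)) = dist (x' (.inr j)) (x' (.inl i)) :=
    fun i j => heq _ _ (by simp)
  have hl_r : (∃ i j : ι, i ≠ j ∧
      dist (x (.inl i)) (x (.inl j)) = dist (x' (.inl i)) (x' (.inl j))) →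
      ∀ k l : κ, dist (x (.inr k)) (x (.inr l)) = dist (x' (.inr k)) (x' (.inr l)) := by
    rintro ⟨i, j, hij, hd⟩ k l
    exact dist_eq_of_orientation (hι.ne hij) hd (hlr i k) (hlr j k) (hlr i l) (hlr j l)
      (hor _ _ _) (hor _ _ _)
  have hr_l : (∃ i j : κ, i ≠ j ∧
      dist (x (.inr i)) (x (.inr j)) = dist (x' (.inr i)) (x' (.inr j))) →
      ∀ k l : ι, dist (x (.inl k)) (x (.inl l)) = dist (x' (.inl k)) (x' (.inl l)) := by
    rintro ⟨i, j, hij, hd⟩ k l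
    exact dist_eq_of_orientation (hκ.ne hij) hd (hrl k i) (hrl k j) (hrl l i) (hrl l j)
      (hor _ _ _) (hor _ _ _)
  obtain ⟨i₀, j₀, hι₀⟩ := exists_pair_ne ι
  obtain ⟨k₀, l₀, hκ₀⟩ := exists_pair_ne κ
  have hall : (∀ k l : ι, dist (x (.inl k)) (x (.inl l)) = dist (x' (.inl k)) (x' (.inl l))) ∧
      ∀ k l : κ, dist (x (.inr k)) (x (.inr l)) = dist (x' (.inr k)) (x' (.inr l)) := by
    rcases hx' heq with h | h
    · have h2 := hl_r h
      exact ⟨hr_l ⟨k₀, l₀, hκ₀, h2 _ _⟩, h2⟩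
    · have h2 := hr_l h
      exact ⟨h2, hl_r ⟨i₀, j₀, hι₀, h2 _ _⟩⟩
  rintro (i | i) (j | j)
  · exact hall.1 i j
  · exact hlr i j
  · exact hrl j i
  · exact hall.2 i j

/-! ### Lines, and the case distinction -/

theorem isLine_affineSpan_pair {a b : Plane} (h : a ≠ b) : IsLine line[ℝ, a, b] := by
  refine ⟨⟨a, left_mem_affineSpan_pair ℝ a b⟩, ?_⟩
  rw [direction_affineSpan, vectorSpan_pair_rev]
  exact finrank_span_singleton (vsub_ne_zero.2 h.symm)

theorem mem_affineSpan_pair_of_signedArea {a b c : Plane} (hab : a ≠ b)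
    (h : signedArea a b c = 0) : c ∈ line[ℝ, a, b] := by
  obtain ⟨t, h0, h1⟩ := exists_coord_of_signedArea_eq_zero hab h
  have : c = AffineMap.lineMap a b t := by
    apply plane_ext
    · simp [AffineMap.lineMap_apply, h0, add_comm]
    · simp [AffineMap.lineMap_apply, h1, add_comm]
  rw [this]
  exact AffineMap.lineMap_mem_affineSpan_pair t a b

/-- Needed when both sides lie on one line, since the two covering lines must be distinct. An only
line would contain every point of the plane. -/
theorem exists_line_ne {l : AffineSubspace ℝ Plane} (hl : IsLine l) :
    ∃ l', IsLine l' ∧ l ≠ l' := by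
  by_contra! h
  obtain ⟨a, ha⟩ := hl.1
  have htop : l = ⊤ := by
    rw [eq_top_iff]
    intro b _
    by_cases hab : a = b
    · rwa [← hab]
    · rw [h _ (isLine_affineSpan_pair hab)]
      exact right_mem_affineSpan_pair ℝ a b
  have hrank := hl.2
  rw [htop, AffineSubspace.direction_top, finrank_top, finrank_euclideanSpace_fin] at hrank
  omega

theorem onPairOfLines_of_collinear {ι κ : Type*} {p : ι → Plane} {q : κ → Plane}
    {l₁ l₂ : AffineSubspace ℝ Plane} (h₁ : IsLine l₁) (h₂ : IsLine l₂) (hp : ∀ i, p i ∈ l₁)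
    (hq : ∀ j, q j ∈ l₂) : OnPairOfLines (Sum.elim p q) := by
  by_cases h : l₁ = l₂
  · subst h
    obtain ⟨l, hl, hne⟩ := exists_line_ne h₁
    refine ⟨l₁, l, h₁, hl, hne, ?_⟩
    rintro (i | j)
    · exact .inl (hp i)
    · exact .inl (hq j)
  · refine ⟨l₁, l₂, h₁, h₂, h, ?_⟩
    rintro (i | j)
    · exact .inl (hp i)
    · exact .inr (hq j)

theorem mainTheorem5 (m : ℕ) (hm : 5 ≤ m) (p : Fin 3 → Plane) (q : Fin m → Plane)
    (hp : Function.Injective p) (hq : Function.Injective q) :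
    IsRigidFramework (completeBipartiteGraph (Fin 3) (Fin m)) (Sum.elim p q) ∨
      OnPairOfLines (Sum.elim p q) := by
  have : Nontrivial (Fin m) := Fin.nontrivial_iff_two_le.2 (by omega)
  set x : Fin 3 ⊕ Fin m → Plane := Sum.elim p q with hx
  have hrigid := isRigidFramework_of_dist_eq (x := x) hp hq
  have harea : ∀ a b c, signedArea (x a) (x b) (x c) ≠ 0 →
      ∀ᶠ x' in 𝓝 x, signedArea (x' a) (x' b) (x' c) ≠ 0 := by
    intro a b c h
    filter_upwards [eventually_same_orientation x] with x' hx'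
    exact right_ne_zero_of_mul (hx' a b c h).ne'
  by_cases hpc : signedArea (p 0) (p 1) (p 2) = 0
  · by_cases hqc : ∃ i j k, signedArea (q i) (q j) (q k) ≠ 0
    · obtain ⟨i, j, k, hijk⟩ := hqc
      left
      apply hrigid
      filter_upwards [harea (.inr i) (.inr j) (.inr k) hijk] with x' hx' heq
      refine .inl ⟨0, 1, by decide, ?_⟩
      -- The roles are swapped: the triangle consists of `q`s and the collinear points are the `p`s.
      exact dist_eq_of_collinear (p := fun n => q (![i, j, k] n))
        (p' := fun n => x' (.inr (![i, j, k] n))) (y := p) (y' := fun n => x' (.inl n)) hx' hp hpc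
        fun n l => heq (.inr _) (.inl l) (by simp)
    · push Not at hqc
      right
      have hp01 := hp.ne (by decide : (0 : Fin 3) ≠ 1)
      have hq01 : q ⟨0, by omega⟩ ≠ q ⟨1, by omega⟩ := hq.ne (by simp)
      refine onPairOfLines_of_collinear (isLine_affineSpan_pair hp01)
        (isLine_affineSpan_pair hq01) ?_ fun j => mem_affineSpan_pair_of_signedArea hq01 (hqc _ _ _)
      intro i
      fin_cases i
      · exact left_mem_affineSpan_pair ℝ _ _
      · exact right_mem_affineSpan_pair ℝ _ _
      · exact mem_affineSpan_pair_of_signedArea hp01 hpc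
  · left
    apply hrigid
    by_cases hqc : ∃ y : Fin 3 → Fin m, Function.Injective y ∧
        signedArea (q (y 0)) (q (y 1)) (q (y 2)) = 0
    · obtain ⟨y, hy, hcol⟩ := hqc
      filter_upwards [harea (.inl 0) (.inl 1) (.inl 2) hpc] with x' hx' heq
      refine .inr ⟨y 0, y 1, hy.ne (by decide), ?_⟩
      exact dist_eq_of_collinear (p := p) (p' := fun n => x' (.inl n)) (y := q ∘ y)
        (y' := fun n => x' (.inr (y n))) hx' (hq.comp hy) hcol
        fun n l => heq (.inl n) (.inr _) (by simp)
    -- The conic case, the only one that needs five points `q j`.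
    · push Not at hqc
      have hcont : Continuous fun (x' : Fin 3 ⊕ Fin m → Plane) (i : Fin 3) => x' (.inl i) := by
        fun_prop
      have hev := eventually_dist_eq (p := p) (q := fun j => q (Fin.castLE hm j)) hpc (by
        intro i j k hij hik hjk
        refine hqc ![Fin.castLE hm i, Fin.castLE hm j, Fin.castLE hm k] ?_
        have := (Fin.castLE_injective hm).ne hij
        have := (Fin.castLE_injective hm).ne hik
        have := (Fin.castLE_injective hm).ne hjk
        intro a b hab
        fin_cases a <;> fin_cases b <;> simp_all)
      filter_upwards [hcont.continuousAt.eventually hev] with x' hx' heq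
      refine .inl ⟨0, 1, by decide, hx' ⟨fun j => x' (.inr (Fin.castLE hm j)), fun i j => ?_⟩⟩
      exact heq (.inl i) (.inr _) (by simp)
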